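/- **Setting.** Let $(\mathcal M,\theta)$ be a compact connected metric space with a non-negative Borel measure $\mu$, normalized by $\mu(\mathcal M)=1$ and $\operatorname{diam}\mathcal M=1$, and let $\mathcal I=[0,1]$. For $y\in\mathcal M$ write $B(y,r)=\{x:\theta(x,y)<r\}$ if $r<1$ (so $B(y,r)=\emptyset$ for $r\le 0$) and $B(y,r)=\mathcal M$ if $r\ge 1$, and put $v(y,r)=\mu(B(y,r))$. Assume: *Condition A.* There are constants $d>0$ and $c_1>0$ with $c_1^{-1}r^d\le v(y,r)\le c_1r^d$ for all $y\in\mathcal M$, $r\in\mathcal I$. *Condition B.* There is a constant $c_2>0$ with $|v(y,r_1)-v(y,r_2)|\le c_2|r_1-r_2|$ for all $y\in\mathcal M$, $r_1,r_2\in\mathcal I$. For an $N$-point subset $\mathcal D_N\subset\mathcal M$ put $L[y,r,\mathcal D_N]=\#(B(y,r)\cap\mathcal D_N)-N\,v(y,r)$. For a probability measure $\xi$ on $\mathcal I$ and $0<p<\infty$ define $$\mathcal L_p[\xi,\mathcal D_N]=\Big(\iint_{\mathcal M\times\mathcal I}|L[y,r,\mathcal D_N]|^p\,d\mu(y)\,d\xi(r)\Big)^{1/p},\qquad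 \mathcal L_\infty[\mathcal D_N]=\sup_{y\in\mathcal M,\,r\in\mathcal I}|L[y,r,\mathcal D_N]|,$$ and let $\lambda_p[\xi,N]=\inf_{\mathcal D_N}\mathcal L_p[\xi,\mathcal D_N]$ and $\lambda_\infty[N]=\inf_{\mathcal D_N}\mathcal L_\infty[\mathcal D_N]$, the infima being over all $N$-point subsets of $\mathcal M$. **Proposition 1.2.** Let $\mathcal M$ be as above and let $\xi_0$ be Lebesgue measure on $\mathcal I$. There are positive constants $c_4,c_5$, depending only on $\mathcal M$ (with its metric and measure), such that for every $N$, every $N$-point subset $\mathcal D_N\subset\mathcal M$, every real $p>1$ and every integer $m\ge c_5$, $$\mathcal L_\infty[\mathcal D_N]\le 2m^{2/p}\,\mathcal L_p[\xi_0,\mathcal D_N]+c_4\,N\,m^{-1/d}.$$ In particular, with the same constants, for every $N$, every real $p>1$ and every integer $m\ge c_5$, $$\lambda_\infty[N]\le 2m^{2/p}\,\lambda_p[\xi_0,N]+c_4\,N\,m^{-1/d}.$$ -/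

import Mathlib

open MeasureTheory

namespace MetricDiscrepancy

noncomputable section

/-- The ball `B(y, r) = {x : θ(x, y) < r}`, with the convention that `B(y, r)` is the whole space
as soon as `r ≥ 1` (the diameter of the space is normalized to `1`).  It is empty for `r ≤ 0`. -/
def cball {M : Type*} [MetricSpace M] (y : M) (r : ℝ) : Set M :=
  {x : M | dist x y < r ∨ 1 ≤ r}

/-- The volume `v(y, r) = μ (B(y, r))`. -/
def vol {M : Type*} [MetricSpace M] [MeasurableSpace M] (μ : Measure M) (y : M) (r : ℝ) : ℝ :=
  μ.real (cball y r)

/-- Condition A (Ahlfors regularity with exponent `d`): for some positive constant `c₁`,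
`c₁⁻¹ r ^ d ≤ v(y, r) ≤ c₁ r ^ d` for all `y` and all `r ∈ [0, 1]`. -/
def ConditionA {M : Type*} [MetricSpace M] [MeasurableSpace M] (μ : Measure M) (d : ℝ) : Prop :=
  0 < d ∧ ∃ c₁ : ℝ, 0 < c₁ ∧ ∀ y : M, ∀ r ∈ Set.Icc (0 : ℝ) 1,
    c₁⁻¹ * r ^ d ≤ vol μ y r ∧ vol μ y r ≤ c₁ * r ^ d

/-- Condition B: the volume `v(y, r)` is Lipschitz in `r ∈ [0, 1]`, uniformly in `y`. -/
def ConditionB {M : Type*} [MetricSpace M] [MeasurableSpace M] (μ : Measure M) : Prop :=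
  ∃ c₂ : ℝ, 0 < c₂ ∧ ∀ y : M, ∀ r₁ ∈ Set.Icc (0 : ℝ) 1, ∀ r₂ ∈ Set.Icc (0 : ℝ) 1,
    |vol μ y r₁ - vol μ y r₂| ≤ c₂ * |r₁ - r₂|

/-- The local discrepancy `#(B(y, r) ∩ D) - N v(y, r)` of the finite set `D`, `N = #D`. -/
def localDiscrepancy {M : Type*} [MetricSpace M] [MeasurableSpace M] (μ : Measure M)
    (D : Finset M) (y : M) (r : ℝ) : ℝ :=
  ((cball y r ∩ (D : Set M)).ncard : ℝ) - (D.card : ℝ) * vol μ y r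

/-- The `L_p`-discrepancy of `D` with respect to a measure `ξ` on the interval `[0, 1]`. -/
def lpDiscrepancy {M : Type*} [MetricSpace M] [MeasurableSpace M] (μ : Measure M)
    (p : ℝ) (ξ : Measure unitInterval) (D : Finset M) : ℝ :=
  (∫ q : M × unitInterval, |localDiscrepancy μ D q.1 (q.2 : ℝ)| ^ p ∂(μ.prod ξ)) ^ (1 / p)

/-- The `L_∞`-discrepancy of `D`: the supremum of the absolute values of the local discrepancies
over all centres `y` and all radii `r ∈ [0, 1]` (they are bounded by `#D` when `μ` is a
probability measure). -/
def linftyDiscrepancy {M : Type*} [MetricSpace M] [MeasurableSpace M] (μ : Measure M)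
    (D : Finset M) : ℝ :=
  ⨆ q : M × unitInterval, |localDiscrepancy μ D q.1 (q.2 : ℝ)|

/-- The extremal `L_p`-discrepancy: the infimum over all `N`-point subsets. -/
def extremalLp {M : Type*} [MetricSpace M] [MeasurableSpace M] (μ : Measure M)
    (p : ℝ) (ξ : Measure unitInterval) (N : ℕ) : ℝ :=
  ⨅ D : {D : Finset M // D.card = N}, lpDiscrepancy μ p ξ D.1

/-- The extremal `L_∞`-discrepancy: the infimum over all `N`-point subsets. -/
def extremalLinfty {M : Type*} [MetricSpace M] [MeasurableSpace M] (μ : Measure M)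
    (N : ℕ) : ℝ :=
  ⨅ D : {D : Finset M // D.card = N}, linftyDiscrepancy μ D.1

end

end MetricDiscrepancy

/-!
A local discrepancy changes in a controlled way when its ball is enlarged: if
`B(y, r) ⊆ B(y', r')`, then `L[y, r] ≤ L[y', r'] + N (v(y', r') - v(y, r))`, because the number of
points can only grow, and by Condition B the volume increment is at most
`c₂ (r' - r + θ(y, y'))` (`localDiscrepancy_le_add`). Put `δ = max(c₁, 1) m ^ (-1/d)` and fix
`(y₀, r₀)`. For all `y ∈ B(y₀, δ)` and all `r ∈ [r₀ + δ, r₀ + 2δ]` the comparison gives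
`L[y₀, r₀] ≤ L[y, r] + 3 c₂ δ N`, and for `r ∈ [r₀ - 2δ, r₀ - δ]` it bounds `-L[y₀, r₀]` in the
same way. When the interval of radii leaves `[0, 1]`, one compares with the radius `1` or `0`
instead, where the local discrepancy vanishes (`abs_localDiscrepancy_le`).

So `|L|` is at least `K = |L[y₀, r₀]| - 3 c₂ δ N` on a box whose measure, by Condition A, is at least
`c₁⁻¹ δ ^ (d + 1)`. Conditions A and B together force `d ≥ 1` (`ConditionA.one_le_of_conditionB`),
hence `m ^ (-1/d) ≥ m⁻¹`, and the box has measure at least `m⁻²`. Chebyshev's inequality on the box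
(`le_mul_lpDiscrepancy`) then yields `K ≤ m ^ (2/p) 𝓛_p`, which is even better than required by a
factor `2`.
-/

namespace MetricDiscrepancy

open MeasureTheory Set

/-! ### Balls with truncated radii -/

section Balls

variable {M : Type*} [MetricSpace M]

lemma cball_subset_cball {y y' : M} {r r' : ℝ} (h : dist y y' ≤ r' - r) :
    cball y r ⊆ cball y' r' := by
  rintro x (hx | hx)
  · left
    have := dist_triangle x y y'
    linarith
  · right
    have := dist_nonneg (x := y) (y := y')
    linarith

lemma cball_eq_univ (y : M) {r : ℝ} (hr : 1 ≤ r) : cball y r = univ :=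
  eq_univ_of_forall fun _ => Or.inr hr

lemma cball_eq_empty (y : M) {r : ℝ} (hr : r ≤ 0) : cball y r = ∅ := by
  ext x
  have := dist_nonneg (x := x) (y := y)
  simp only [cball, mem_ofPred_eq, mem_empty_iff_false, iff_false, not_or, not_lt, not_le]
  constructor <;> linarith

lemma cball_of_lt_one (y : M) {r : ℝ} (hr : r < 1) : cball y r = Metric.ball y r := by
  ext x
  simp [cball, not_le.mpr hr]

/-- `B(y, r)` depends only on the projection of `r` to `[0, 1]`. -/
lemma cball_projIcc (y : M) (r : ℝ) :
    cball y (projIcc (0 : ℝ) 1 zero_le_one r : ℝ) = cball y r := by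
  rcases le_total r 0 with h | h
  · rw [projIcc_of_le_left _ h, cball_eq_empty y h, cball_eq_empty y le_rfl]
  rcases le_total 1 r with h' | h'
  · rw [projIcc_of_right_le _ h', cball_eq_univ y h', cball_eq_univ y le_rfl]
  · rw [projIcc_of_mem _ ⟨h, h'⟩]

end Balls

/-! ### Volumes of balls -/

variable {M : Type*} [MetricSpace M] [MeasurableSpace M] {μ : Measure M}

lemma vol_mono [IsProbabilityMeasure μ] {y y' : M} {r r' : ℝ} (h : dist y y' ≤ r' - r) :
    vol μ y r ≤ vol μ y' r' :=
  measureReal_mono (cball_subset_cball h)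

/-- The Lipschitz bound of Condition B holds for all real radii, since `v(y, r)` depends only on
the projection of `r` to `[0, 1]`. -/
lemma vol_sub_le_of_lipschitz {c₂ : ℝ} (hc₂ : 0 < c₂)
    (hB : ∀ y : M, ∀ r₁ ∈ Icc (0 : ℝ) 1, ∀ r₂ ∈ Icc (0 : ℝ) 1,
      |vol μ y r₁ - vol μ y r₂| ≤ c₂ * |r₁ - r₂|) (y : M) (r s : ℝ) :
    vol μ y r - vol μ y s ≤ c₂ * |r - s| := by
  have key := hB y _ (projIcc (0 : ℝ) 1 zero_le_one r).2 _ (projIcc (0 : ℝ) 1 zero_le_one s).2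
  have hv (t : ℝ) : vol μ y (projIcc (0 : ℝ) 1 zero_le_one t : ℝ) = vol μ y t := by
    simp only [vol, cball_projIcc]
  rw [hv, hv] at key
  exact (le_abs_self _).trans (key.trans
    (mul_le_mul_of_nonneg_left (abs_projIcc_sub_projIcc zero_le_one) hc₂.le))

/-- Near `0` the volume is at least of order `r ^ d` by Condition A, and at most of order `r` by
Condition B. -/
lemma ConditionA.one_le_of_conditionB [Nonempty M] {d : ℝ} (hA : ConditionA μ d)
    (hB : ConditionB μ) : 1 ≤ d := by
  obtain ⟨-, c₁, hc₁, hA⟩ := hA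
  obtain ⟨c₂, hc₂, hB⟩ := hB
  obtain ⟨y⟩ := ‹Nonempty M›
  by_contra! hd
  have hC : 0 < c₁ * c₂ := mul_pos hc₁ hc₂
  -- the radius at which `r ^ (d - 1)` equals `c₁ c₂ + 1`
  set r : ℝ := (c₁ * c₂ + 1) ^ ((d - 1)⁻¹) with hr
  have hr0 : 0 < r := by positivity
  have hr1 : r ≤ 1 :=
    Real.rpow_le_one_of_one_le_of_nonpos (by linarith) (inv_nonpos.mpr (by linarith))
  have hrd : r ^ (d - 1) = c₁ * c₂ + 1 :=
    Real.rpow_inv_rpow (by positivity) (by linarith)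
  have h1 := (hA y r ⟨hr0.le, hr1⟩).1
  have h2 := vol_sub_le_of_lipschitz hc₂ hB y r 0
  have h3 : vol μ y 0 = 0 := by simp [vol, cball_eq_empty y le_rfl]
  rw [h3, sub_zero, sub_zero, abs_of_pos hr0] at h2
  have h4 : r ^ d = (c₁ * c₂ + 1) * r := by
    rw [← hrd, ← Real.rpow_add_one hr0.ne', sub_add_cancel]
  have h5 : r ^ d ≤ c₁ * (c₂ * r) := (inv_mul_le_iff₀ hc₁).mp (h1.trans h2)
  nlinarith

/-! ### Local discrepancies -/

section LocalDiscrepancy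

lemma localDiscrepancy_of_nonpos (D : Finset M) (y : M) {r : ℝ} (hr : r ≤ 0) :
    localDiscrepancy μ D y r = 0 := by
  simp [localDiscrepancy, vol, cball_eq_empty y hr]

lemma localDiscrepancy_of_one_le [IsProbabilityMeasure μ] (D : Finset M) (y : M) {r : ℝ}
    (hr : 1 ≤ r) : localDiscrepancy μ D y r = 0 := by
  simp [localDiscrepancy, vol, cball_eq_univ y hr]

/-- Comparison of the local discrepancies of the nested balls `B(y, r) ⊆ B(y', r')`. -/
lemma localDiscrepancy_le_add [IsProbabilityMeasure μ] {c₂ : ℝ} (hc₂ : 0 < c₂)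
    (hB : ∀ y : M, ∀ r₁ ∈ Icc (0 : ℝ) 1, ∀ r₂ ∈ Icc (0 : ℝ) 1,
      |vol μ y r₁ - vol μ y r₂| ≤ c₂ * |r₁ - r₂|) (D : Finset M) {y y' : M} {r r' : ℝ}
    (h : dist y y' ≤ r' - r) :
    localDiscrepancy μ D y r ≤
      localDiscrepancy μ D y' r' + D.card * (c₂ * (r' - r + dist y y')) := by
  have hcount : ((cball y r ∩ (D : Set M)).ncard : ℝ) ≤ ((cball y' r' ∩ (D : Set M)).ncard : ℝ) :=
    Nat.cast_le.mpr (ncard_le_ncard (inter_subset_inter_left _ (cball_subset_cball h))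
      (D.finite_toSet.inter_of_right _))
  have h0 : 0 ≤ dist y y' := dist_nonneg
  have hvol : vol μ y' r' - vol μ y r ≤ c₂ * (r' - r + dist y y') := by
    have h1 : vol μ y' r' ≤ vol μ y (r' + dist y y') :=
      vol_mono (by rw [dist_comm]; linarith)
    have h2 := vol_sub_le_of_lipschitz hc₂ hB y (r' + dist y y') r
    rw [abs_of_nonneg (by linarith)] at h2
    have h3 : r' + dist y y' - r = r' - r + dist y y' := by ring
    rw [h3] at h2
    linarith
  have hN : (0 : ℝ) ≤ D.card := Nat.cast_nonneg _
  have := mul_le_mul_of_nonneg_left hvol hN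
  unfold localDiscrepancy
  linarith

lemma abs_localDiscrepancy_le_card [IsProbabilityMeasure μ] (D : Finset M) (y : M) (r : ℝ) :
    |localDiscrepancy μ D y r| ≤ D.card := by
  have h1 : ((cball y r ∩ (D : Set M)).ncard : ℝ) ≤ D.card := by
    rw [← ncard_coe_finset D]
    exact_mod_cast ncard_le_ncard inter_subset_right D.finite_toSet
  have h2 : (0 : ℝ) ≤ ((cball y r ∩ (D : Set M)).ncard : ℝ) := Nat.cast_nonneg _
  have h3 : vol μ y r ≤ 1 := measureReal_le_one
  have h4 : 0 ≤ vol μ y r := measureReal_nonneg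
  have h5 : (0 : ℝ) ≤ D.card := Nat.cast_nonneg _
  rw [localDiscrepancy, abs_le]
  constructor <;> nlinarith

lemma lpDiscrepancy_nonneg (p : ℝ) (ξ : Measure unitInterval) (D : Finset M) :
    0 ≤ lpDiscrepancy μ p ξ D :=
  Real.rpow_nonneg (integral_nonneg fun _ => by positivity) _

/-! ### Measurability and Chebyshev's inequality -/

variable [CompactSpace M] [BorelSpace M]

lemma measurableSet_mem_cball :
    MeasurableSet {z : (M × unitInterval) × M | z.2 ∈ cball z.1.1 (z.1.2 : ℝ)} := by
  have h1 : MeasurableSet {z : (M × unitInterval) × M | dist z.2 z.1.1 < (z.1.2 : ℝ)} :=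
    measurableSet_lt (by fun_prop) (by fun_prop)
  have h2 : MeasurableSet {z : (M × unitInterval) × M | (1 : ℝ) ≤ (z.1.2 : ℝ)} :=
    measurableSet_le (by fun_prop) (by fun_prop)
  exact h1.union h2

lemma measurable_localDiscrepancy [IsProbabilityMeasure μ] (D : Finset M) :
    Measurable fun q : M × unitInterval => localDiscrepancy μ D q.1 (q.2 : ℝ) := by
  classical
  have hcount : (fun q : M × unitInterval => ((cball q.1 (q.2 : ℝ) ∩ (D : Set M)).ncard : ℝ)) =
      fun q => ∑ x ∈ D, {q : M × unitInterval | x ∈ cball q.1 (q.2 : ℝ)}.indicator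
        (fun _ => (1 : ℝ)) q := by
    funext q
    have hset : cball q.1 (q.2 : ℝ) ∩ (D : Set M) =
        ((D.filter fun x => x ∈ cball q.1 (q.2 : ℝ) : Finset M) : Set M) := by
      ext x; simp [and_comm]
    rw [hset, ncard_coe_finset, Finset.card_filter]
    push_cast
    exact Finset.sum_congr rfl fun x _ => by simp [indicator_apply]
  have hvol : Measurable fun q : M × unitInterval => vol μ q.1 (q.2 : ℝ) :=
    (measurable_measure_prodMk_left (ν := μ) measurableSet_mem_cball).ennreal_toReal
  have hc : Measurable fun q : M × unitInterval =>
      ((cball q.1 (q.2 : ℝ) ∩ (D : Set M)).ncard : ℝ) := by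
    rw [hcount]
    refine Finset.measurable_fun_sum _ fun x _ => measurable_const.indicator ?_
    exact measurableSet_mem_cball.preimage (measurable_id.prodMk (measurable_const (a := x)))
  exact hc.sub (hvol.const_mul _)

lemma integrable_abs_localDiscrepancy_rpow [IsProbabilityMeasure μ] (D : Finset M) {p : ℝ}
    (hp : 0 ≤ p) (ξ : Measure unitInterval) [IsProbabilityMeasure ξ] :
    Integrable (fun q : M × unitInterval => |localDiscrepancy μ D q.1 (q.2 : ℝ)| ^ p)
      (μ.prod ξ) := by
  refine Integrable.of_bound (C := (D.card : ℝ) ^ p) ?_ (ae_of_all _ fun q => ?_)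
  · exact ((measurable_localDiscrepancy D).abs.pow_const p).aestronglyMeasurable
  · rw [Real.norm_of_nonneg (by positivity)]
    exact Real.rpow_le_rpow (abs_nonneg _) (abs_localDiscrepancy_le_card D _ _) hp

/-- Chebyshev's inequality for the `L_p`-discrepancy on a box `s × t` of measure at least `ε`. -/
lemma le_mul_lpDiscrepancy [IsProbabilityMeasure μ] (D : Finset M) {p K ε : ℝ} (hp : 0 < p)
    (hε : 0 < ε) (ξ : Measure unitInterval) [IsProbabilityMeasure ξ] {s : Set M}
    {t : Set unitInterval} (hs : MeasurableSet s) (ht : MeasurableSet t)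
    (hst : ε ≤ μ.real s * ξ.real t)
    (hK : ∀ y ∈ s, ∀ r ∈ t, K ≤ |localDiscrepancy μ D y (r : ℝ)|) :
    K ≤ (ε⁻¹) ^ (1 / p) * lpDiscrepancy μ p ξ D := by
  rcases le_total K 0 with hK0 | hK0
  · exact hK0.trans (mul_nonneg (by positivity) (lpDiscrepancy_nonneg _ _ _))
  have hint := integrable_abs_localDiscrepancy_rpow (μ := μ) D hp.le ξ
  set f : M × unitInterval → ℝ := fun q => |localDiscrepancy μ D q.1 (q.2 : ℝ)| ^ p with hf
  have hbox : K ^ p * (μ.prod ξ).real (s ×ˢ t) ≤ ∫ q in s ×ˢ t, f q ∂(μ.prod ξ) :=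
    setIntegral_ge_of_const_le_real (hs.prod ht) (measure_ne_top _ _)
      (fun q hq => Real.rpow_le_rpow hK0 (hK _ hq.1 _ hq.2) hp.le) hint.integrableOn
  have hle : ∫ q in s ×ˢ t, f q ∂(μ.prod ξ) ≤ ∫ q, f q ∂(μ.prod ξ) :=
    setIntegral_le_integral hint (ae_of_all _ fun q => by simp only [hf]; positivity)
  rw [measureReal_prod_prod] at hbox
  have hKp : 0 ≤ K ^ p := by positivity
  have h1 : K ^ p ≤ ε⁻¹ * ∫ q, f q ∂(μ.prod ξ) := by
    rw [le_inv_mul_iff₀ hε]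
    nlinarith
  have hI : 0 ≤ ∫ q, f q ∂(μ.prod ξ) := integral_nonneg fun _ => by positivity
  calc K = (K ^ p) ^ (1 / p) := by rw [one_div, Real.rpow_rpow_inv hK0 hp.ne']
    _ ≤ (ε⁻¹ * ∫ q, f q ∂(μ.prod ξ)) ^ (1 / p) := Real.rpow_le_rpow hKp h1 (by positivity)
    _ = (ε⁻¹) ^ (1 / p) * lpDiscrepancy μ p ξ D := by
      rw [Real.mul_rpow (by positivity) hI]
      rfl

/-! ### The bound at scale `δ` -/

/-- The bound for one ball at a fixed scale `δ`: `ε` is a lower bound for the measure of the boxes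
`B(y₀, δ) × [a, a + δ]`. No smallness of `δ` is needed: such a box is used only when its radii lie
in `[0, 1]`, and the radii `1` and `0` serve otherwise. -/
lemma abs_localDiscrepancy_le [IsProbabilityMeasure μ] {c₂ : ℝ} (hc₂ : 0 < c₂)
    (hB : ∀ y : M, ∀ r₁ ∈ Icc (0 : ℝ) 1, ∀ r₂ ∈ Icc (0 : ℝ) 1,
      |vol μ y r₁ - vol μ y r₂| ≤ c₂ * |r₁ - r₂|) (D : Finset M) {p δ ε : ℝ} (hp : 0 < p)
    (hδ : 0 < δ) (hε : 0 < ε) (y₀ : M) (hvol : δ < 1 → ε ≤ vol μ y₀ δ * δ) {r₀ : ℝ}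
    (hr₀ : r₀ ∈ Icc (0 : ℝ) 1) :
    |localDiscrepancy μ D y₀ r₀| ≤
      (ε⁻¹) ^ (1 / p) * lpDiscrepancy μ p (volume : Measure unitInterval) D
        + D.card * (c₂ * (3 * δ)) := by
  obtain ⟨h0, h1⟩ := hr₀
  have hN : (0 : ℝ) ≤ D.card := Nat.cast_nonneg _
  have hLp := lpDiscrepancy_nonneg (μ := μ) p (volume : Measure unitInterval) D
  have hmain : 0 ≤ (ε⁻¹) ^ (1 / p) * lpDiscrepancy μ p (volume : Measure unitInterval) D := by
    positivity
  have hmono {a : ℝ} (ha : a ≤ 3 * δ) : (D.card : ℝ) * (c₂ * a) ≤ D.card * (c₂ * (3 * δ)) :=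
    mul_le_mul_of_nonneg_left (mul_le_mul_of_nonneg_left ha hc₂.le) hN
  have havg {a K : ℝ} (ha0 : 0 ≤ a) (ha1 : a + δ ≤ 1) (hδ1 : δ < 1)
      (hK : ∀ y, dist y y₀ < δ → ∀ r, a ≤ r → r ≤ a + δ → K ≤ |localDiscrepancy μ D y r|) :
      K ≤ (ε⁻¹) ^ (1 / p) * lpDiscrepancy μ p (volume : Measure unitInterval) D := by
    have hball : cball y₀ δ = Metric.ball y₀ δ := cball_of_lt_one y₀ hδ1
    refine le_mul_lpDiscrepancy D hp hε _ (s := Metric.ball y₀ δ)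
      (t := Icc (⟨a, ha0, by linarith⟩ : unitInterval) ⟨a + δ, by linarith, ha1⟩)
      Metric.isOpen_ball.measurableSet measurableSet_Icc ?_
      fun y hy r hr => hK y hy r hr.1 hr.2
    have hI : (volume : Measure unitInterval).real
        (Icc (⟨a, ha0, by linarith⟩ : unitInterval) ⟨a + δ, by linarith, ha1⟩) = δ := by
      simp [measureReal_def, unitInterval.volume_Icc, hδ.le]
    rw [hI, ← hball]
    exact hvol hδ1
  rw [abs_le']
  constructor
  · rcases le_or_gt (r₀ + 2 * δ) 1 with h | h
    · refine sub_le_iff_le_add.mp (havg (a := r₀ + δ) (by linarith) (by linarith) (by linarith)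
        fun y hy r hr hr' => ?_)
      rw [dist_comm] at hy
      have hcmp := localDiscrepancy_le_add hc₂ hB D (y := y₀) (y' := y) (r := r₀) (r' := r)
        (by linarith)
      have := hmono (a := r - r₀ + dist y₀ y) (by linarith)
      have := le_abs_self (localDiscrepancy μ D y r)
      linarith
    · -- the whole space is at most `2δ` away in radius
      have hcmp := localDiscrepancy_le_add hc₂ hB D (y := y₀) (y' := y₀) (r := r₀) (r' := 1)
        (by rw [dist_self]; linarith)
      rw [localDiscrepancy_of_one_le D y₀ le_rfl, dist_self] at hcmp
      have := hmono (a := 1 - r₀ + 0) (by linarith)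
      linarith
  · rcases le_or_gt (2 * δ) r₀ with h | h
    · refine sub_le_iff_le_add.mp (havg (a := r₀ - 2 * δ) (by linarith) (by linarith)
        (by linarith) fun y hy r hr hr' => ?_)
      have hcmp := localDiscrepancy_le_add hc₂ hB D (y := y) (y' := y₀) (r := r) (r' := r₀)
        (by linarith)
      have := hmono (a := r₀ - r + dist y y₀) (by linarith)
      have := neg_le_abs (localDiscrepancy μ D y r)
      linarith
    · -- the empty ball is at most `2δ` away in radius
      have hcmp := localDiscrepancy_le_add hc₂ hB D (y := y₀) (y' := y₀) (r := 0) (r' := r₀)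
        (by rw [dist_self]; linarith)
      rw [localDiscrepancy_of_nonpos D y₀ le_rfl, dist_self] at hcmp
      have := hmono (a := r₀ - 0 + 0) (by linarith)
      linarith

end LocalDiscrepancy

/-- The choice of scale `δ = max(c₁, 1) m ^ (-1/d)`; this is where `d ≥ 1` is needed. -/
lemma inv_sq_le_scale {c₁ d m : ℝ} (hc₁ : 0 < c₁) (hd : 1 ≤ d) (hm : 1 ≤ m) :
    (m ^ 2)⁻¹ ≤ c₁⁻¹ * (max c₁ 1 * m ^ (-1 / d)) ^ d * (max c₁ 1 * m ^ (-1 / d)) := by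
  have hm0 : 0 < m := by linarith
  have hA1 : 1 ≤ max c₁ 1 := le_max_right _ _
  have hA : 0 < max c₁ 1 := by linarith
  have h1 : (m ^ (-1 / d)) ^ d = m⁻¹ := by
    rw [← Real.rpow_mul hm0.le, div_mul_cancel₀ _ (by linarith), Real.rpow_neg_one]
  have h2 : m⁻¹ ≤ m ^ (-1 / d) := by
    rw [← Real.rpow_neg_one]
    refine Real.rpow_le_rpow_of_exponent_le hm ?_
    rw [neg_div, neg_le_neg_iff, div_le_one (by linarith)]
    exact hd
  have h3 : 1 ≤ c₁⁻¹ * max c₁ 1 := by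
    rw [le_inv_mul_iff₀ hc₁, mul_one]
    exact le_max_left _ _
  have h4 : 1 ≤ (max c₁ 1) ^ d := Real.one_le_rpow hA1 (by linarith)
  rw [Real.mul_rpow hA.le (by positivity), h1]
  calc (m ^ 2)⁻¹ = 1 * 1 * (m⁻¹ * m⁻¹) := by rw [sq, mul_inv]; ring
    _ ≤ (c₁⁻¹ * max c₁ 1) * (max c₁ 1) ^ d * (m⁻¹ * m ^ (-1 / d)) := by gcongr
    _ = _ := by ring

end MetricDiscrepancy

/-! ### Extremal discrepancies -/

theorem proposition1p2 {M : Type*} [MetricSpace M] [CompactSpace M] [ConnectedSpace M]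
    [MeasurableSpace M] [BorelSpace M] (μ : MeasureTheory.Measure M)
    [MeasureTheory.IsProbabilityMeasure μ]
    (hdiam : Metric.diam (Set.univ : Set M) = 1) (d : ℝ)
    (hA : MetricDiscrepancy.ConditionA μ d) (hB : MetricDiscrepancy.ConditionB μ) :
    ∃ c₄ c₅ : ℝ, 0 < c₄ ∧ 0 < c₅ ∧
      (∀ (N : ℕ) (D : Finset M), D.card = N → ∀ p : ℝ, 1 < p → ∀ m : ℕ, c₅ ≤ (m : ℝ) →
        MetricDiscrepancy.linftyDiscrepancy μ D ≤
          2 * (m : ℝ) ^ (2 / p) *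
              MetricDiscrepancy.lpDiscrepancy μ p (MeasureTheory.volume : MeasureTheory.Measure unitInterval) D
            + c₄ * (N : ℝ) * (m : ℝ) ^ (-1 / d)) ∧
      (∀ (N : ℕ) (p : ℝ), 1 < p → ∀ m : ℕ, c₅ ≤ (m : ℝ) →
        MetricDiscrepancy.extremalLinfty (M := M) μ N ≤
          2 * (m : ℝ) ^ (2 / p) *
              MetricDiscrepancy.extremalLp μ p (MeasureTheory.volume : MeasureTheory.Measure unitInterval) N
            + c₄ * (N : ℝ) * (m : ℝ) ^ (-1 / d)) := by
  have hd1 : 1 ≤ d := hA.one_le_of_conditionB hB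
  obtain ⟨hd, c₁, hc₁, hA⟩ := hA
  obtain ⟨c₂, hc₂, hB⟩ := hB
  have hbound : ∀ (N : ℕ) (D : Finset M), D.card = N → ∀ p : ℝ, 1 < p → ∀ m : ℕ,
      (1 : ℝ) ≤ (m : ℝ) → MetricDiscrepancy.linftyDiscrepancy μ D ≤
        2 * (m : ℝ) ^ (2 / p) * MetricDiscrepancy.lpDiscrepancy μ p
            (MeasureTheory.volume : MeasureTheory.Measure unitInterval) D
          + 3 * c₂ * max c₁ 1 * (N : ℝ) * (m : ℝ) ^ (-1 / d) := by
    rintro N D rfl p hp m hm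
    have hm0 : (0 : ℝ) < m := by linarith
    refine ciSup_le fun q => ?_
    have hscale := MetricDiscrepancy.inv_sq_le_scale hc₁ hd1 hm
    have hδ : 0 < max c₁ 1 * (m : ℝ) ^ (-1 / d) := by positivity
    have key := MetricDiscrepancy.abs_localDiscrepancy_le hc₂ hB D (p := p) (by linarith) hδ
      (ε := ((m : ℝ) ^ 2)⁻¹) (by positivity) q.1
      (fun h1 => hscale.trans (mul_le_mul_of_nonneg_right (hA q.1 _ ⟨hδ.le, h1.le⟩).1 hδ.le))
      q.2.2
    have hpow : (((m : ℝ) ^ 2)⁻¹⁻¹) ^ (1 / p) = (m : ℝ) ^ (2 / p) := by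
      rw [inv_inv, ← Real.rpow_natCast, ← Real.rpow_mul hm0.le]
      congr 1
      push_cast
      ring
    rw [hpow] at key
    have hLp : 0 ≤ (m : ℝ) ^ (2 / p) * MetricDiscrepancy.lpDiscrepancy μ p
        (MeasureTheory.volume : MeasureTheory.Measure unitInterval) D :=
      mul_nonneg (by positivity) (MetricDiscrepancy.lpDiscrepancy_nonneg _ _ _)
    linarith
  refine ⟨3 * c₂ * max c₁ 1, 1, by positivity, one_pos, hbound, fun N p hp m hm => ?_⟩
  have hm0 : (0 : ℝ) < m := by linarith
  -- a connected space of positive diameter is infinite, so there are `N`-point subsets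
  have hnt : (Set.univ : Set M).Nontrivial := by
    by_contra h
    rw [Set.not_nontrivial_iff] at h
    rw [Metric.diam_subsingleton h] at hdiam
    exact zero_ne_one hdiam
  have hinf : Infinite M :=
    Set.infinite_univ_iff.mp (isPreconnected_univ.infinite_of_nontrivial hnt)
  obtain ⟨D₀, hD₀⟩ := Infinite.exists_subset_card_eq M N
  have : Nonempty {D : Finset M // D.card = N} := ⟨⟨D₀, hD₀⟩⟩
  have hA2 : 0 < 2 * (m : ℝ) ^ (2 / p) := by positivity
  rw [← sub_le_iff_le_add, ← div_le_iff₀' hA2]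
  refine le_ciInf fun D => ?_
  rw [div_le_iff₀' hA2, sub_le_iff_le_add]
  refine (ciInf_le ⟨0, ?_⟩ D).trans (hbound N D.1 D.2 p hp m hm)
  rintro _ ⟨E, rfl⟩
  exact Real.iSup_nonneg fun _ => abs_nonneg _
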